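/- Let $G$ be a compact Lie group and let $\rho : G \to O(V)$ be a (smooth) orthogonal representation on a finite-dimensional Euclidean space $V$. For $x\in V$ let $Gx$ be its orbit, $T_x(Gx)$ the tangent space of the orbit at $x$, and $\nu_x(Gx)=T_x(Gx)^{\perp}\subset V$ the normal space. Each element $X$ of the Lie algebra of $G$ induces the $G$-Killing vector field $X^*_x=\frac{d}{dt}\big|_{t=0}\rho(\exp tX)x$ on $V$. A geodesic (affinely parametrized straight line) of $V$ is called horizontal if it is orthogonal to one orbit that it meets (and hence to every orbit it meets). Given an orbit $N$ and a horizontal geodesic $\gamma$ with $\gamma(0)\in N$, an $N$-Jacobi field along $\gamma$ is the variational field of a smooth variation of $\gamma$ through horizontal geodesics starting at $N$. The representation is called variationally complete if, for every orbit $N$ and every horizontal geodesic $\gamma$ starting at $N$, every $N$-Jacobi field along $\gamma$ that vanishes for some $t>0$ is the restriction to $\gamma$ of a $G$-Killing vector field. A section is a complete connected (injectively) immersed smooth submanifold $\Sigma\subset V$ which meets every orbit and is perpendicular to every orbit at every point of intersection; the representation is called polar if it admits a section. A point $p\in V$ is called principal if, for all $q$ in a neighborhood of $p$, the isotropy group $G_p$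 is conjugate in $G$ to a subgroup of $G_q$. Theorem (Di Scala–Olmos). If $\rho$ is variationally complete, then $\rho$ is polar. Moreover, for every principal point $p\in V$, the normal space $\nu_p(Gp)$, regarded as a linear subspace of $V$, is a section. -/

import Mathlib

open Set Filter Topology MeasureTheory
open scoped Manifold ContDiff ENNReal

noncomputable section

namespace PolarRep

section Immersed

variable {V : Type*} [NormedAddCommGroup V] [InnerProductSpace ℝ V] [FiniteDimensional ℝ V]
  (k : ℕ) {M : Type*} [TopologicalSpace M] [ChartedSpace (EuclideanSpace ℝ (Fin k)) M]

/-- `M` is metrically complete for the Riemannian metric induced by `ι : M → V`. The Riemannian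
distance is the infimum of the lengths of `C^1` paths, so a sequence is Cauchy if and only if its
terms of large index are joined in `M` by `C^1` paths whose images under `ι` are arbitrarily
short. -/
def IsCompleteInduced (ι : M → V) : Prop :=
  ∀ x : ℕ → M,
    (∀ ε : ℝ≥0∞, 0 < ε → ∃ n₀ : ℕ, ∀ m n : ℕ, n₀ ≤ m → n₀ ≤ n →
      ∃ c : ℝ → M, ContMDiffOn 𝓘(ℝ, ℝ) (𝓡 k) 1 c (Icc 0 1) ∧ c 0 = x m ∧ c 1 = x n ∧
        ∫⁻ t in Icc (0 : ℝ) 1, ‖deriv (fun s : ℝ => ι (c s)) t‖ₑ < ε) →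
    ∃ y : M, Tendsto x atTop (𝓝 y)

/-- The map `ι : M → V` exhibits its image as a complete connected (injectively) immersed smooth
`k`-dimensional submanifold of `V`. -/
structure IsCompleteConnectedImmersion (ι : M → V) : Prop where
  isManifold : IsManifold (𝓡 k) ∞ M
  t2 : T2Space M
  secondCountable : SecondCountableTopology M
  connected : ConnectedSpace M
  smooth : ContMDiff (𝓡 k) 𝓘(ℝ, V) ∞ ι
  injective : Function.Injective ι
  immersion : ∀ x : M, Function.Injective (mfderiv (𝓡 k) 𝓘(ℝ, V) ι x)
  complete : IsCompleteInduced k ι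

end Immersed

section Representation

universe u

variable {E : Type*} [NormedAddCommGroup E] [NormedSpace ℝ E]
  {G : Type*} [Group G] [TopologicalSpace G] [ChartedSpace E G]
  {V : Type u} [NormedAddCommGroup V] [InnerProductSpace ℝ V] [FiniteDimensional ℝ V]

/-- An orthogonal representation `ρ` of a Lie group on `V` is smooth. As `V` is finite-dimensional
and the action is linear, smoothness of all orbit maps is smoothness of `G × V → V`. -/
def IsSmoothRep (ρ : G →* (V ≃ₗᵢ[ℝ] V)) : Prop :=
  ∀ v : V, ContMDiff 𝓘(ℝ, E) 𝓘(ℝ, V) ∞ (fun g : G => ρ g v)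

/-- The orbit `G x`. -/
def orbit (ρ : G →* (V ≃ₗᵢ[ℝ] V)) (x : V) : Set V :=
  range (fun g : G => ρ g x)

/-- The differential at the identity of the orbit map `g ↦ ρ g x`, from the Lie algebra to `V`. -/
def orbitDeriv (ρ : G →* (V ≃ₗᵢ[ℝ] V)) (x : V) : GroupLieAlgebra 𝓘(ℝ, E) G →L[ℝ] V :=
  mfderiv 𝓘(ℝ, E) 𝓘(ℝ, V) (fun g : G => ρ g x) 1

/-- The `G`-Killing vector field `X^*` on `V` induced by an element `X` of the Lie algebra. -/
def killing (ρ : G →* (V ≃ₗᵢ[ℝ] V)) (X : GroupLieAlgebra 𝓘(ℝ, E) G) (x : V) : V :=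
  orbitDeriv ρ x X

/-- The tangent space at `x` of the orbit `G x`, a linear subspace of `V`. -/
def orbitTangent (ρ : G →* (V ≃ₗᵢ[ℝ] V)) (x : V) : Submodule ℝ V :=
  LinearMap.range (orbitDeriv (E := E) ρ x).toLinearMap

/-- The normal space at `x` of the orbit `G x`. -/
def orbitNormal (ρ : G →* (V ≃ₗᵢ[ℝ] V)) (x : V) : Submodule ℝ V :=
  (orbitTangent (E := E) ρ x)ᗮ

/-- The geodesics of a Euclidean space: affinely parametrized straight lines. -/
def IsGeodesic (γ : ℝ → V) : Prop :=
  ∃ x v : V, ∀ s : ℝ, γ s = x + s • v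

/-- A geodesic is horizontal if it is orthogonal to an orbit that it meets. -/
def IsHorizontalGeodesic (ρ : G →* (V ≃ₗᵢ[ℝ] V)) (γ : ℝ → V) : Prop :=
  IsGeodesic γ ∧ ∃ s : ℝ, deriv γ s ∈ orbitNormal (E := E) ρ (γ s)

/-- `J` is an `N`-Jacobi field along `γ`: the variational field of a smooth variation `F` of `γ`
(with parameter the first variable) through horizontal geodesics starting at `N`. -/
def IsOrbitJacobi (ρ : G →* (V ≃ₗᵢ[ℝ] V)) (N : Set V) (γ J : ℝ → V) : Prop :=
  ∃ ε : ℝ, 0 < ε ∧ ∃ F : ℝ → ℝ → V,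
    ContDiffOn ℝ ∞ (fun z : ℝ × ℝ => F z.1 z.2) (Ioo (-ε) ε ×ˢ univ) ∧
    F 0 = γ ∧
    (∀ t ∈ Ioo (-ε) ε, IsHorizontalGeodesic (E := E) ρ (F t) ∧ F t 0 ∈ N) ∧
    ∀ s : ℝ, J s = deriv (fun t : ℝ => F t s) 0

/-- Variational completeness: for every orbit `N` and every horizontal geodesic `γ` starting at
`N`, every `N`-Jacobi field along `γ` that vanishes for some positive time is the restriction
to `γ` of a `G`-Killing vector field. -/
def IsVariationallyComplete (ρ : G →* (V ≃ₗᵢ[ℝ] V)) : Prop :=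
  ∀ (x : V) (γ J : ℝ → V), IsHorizontalGeodesic (E := E) ρ γ → γ 0 ∈ orbit ρ x →
    IsOrbitJacobi (E := E) ρ (orbit ρ x) γ J → (∃ t : ℝ, 0 < t ∧ J t = 0) →
    ∃ X : GroupLieAlgebra 𝓘(ℝ, E) G, ∀ s : ℝ, J s = killing ρ X (γ s)

/-- `S` is a section: a complete connected immersed submanifold that meets all the orbits and is
perpendicular to every orbit at every point of intersection. -/
def IsSection (ρ : G →* (V ≃ₗᵢ[ℝ] V)) (S : Set V) : Prop :=
  ∃ (k : ℕ) (M : Type u) (_ : TopologicalSpace M)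
    (_ : ChartedSpace (EuclideanSpace ℝ (Fin k)) M) (ι : M → V),
    IsCompleteConnectedImmersion k ι ∧ range ι = S ∧
    (∀ x : V, (S ∩ orbit ρ x).Nonempty) ∧
    ∀ y : M, ∀ w : TangentSpace (𝓡 k) y,
      (mfderiv (𝓡 k) 𝓘(ℝ, V) ι y w : V) ∈ orbitNormal (E := E) ρ (ι y)

/-- A representation is polar if it admits a section. -/
def IsPolar (ρ : G →* (V ≃ₗᵢ[ℝ] V)) : Prop :=
  ∃ S : Set V, IsSection (E := E) ρ S

/-- `p` is a principal point: for all `q` near `p`, the isotropy group of `p` is conjugate in `G`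
to a subgroup of the isotropy group of `q`. -/
def IsPrincipal (ρ : G →* (V ≃ₗᵢ[ℝ] V)) (p : V) : Prop :=
  ∀ᶠ q in 𝓝 p, ∃ g : G, ∀ h : G, ρ h p = p → ρ (g * h * g⁻¹) q = q

end Representation

end PolarRep

end

noncomputable section

namespace PolarRep

/-! ### Infinitesimal action and the geometry of orbits. -/

section OrbitMap

variable {E : Type*} [NormedAddCommGroup E] [NormedSpace ℝ E]
  {G : Type*} [Group G] [TopologicalSpace G] [ChartedSpace E G]
  {V : Type*} [NormedAddCommGroup V] [InnerProductSpace ℝ V]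
  {ρ : G →* (V ≃ₗᵢ[ℝ] V)}

/-! Write Xv for `hρ.action v X`. Call p regular if no nearby orbit has larger dimension; principal
points are regular, and regular points always exist. At a regular p, any X with Xp = 0 kills the
whole normal space ν (`IsRegular.action_eq_zero`): by constancy of rank Xξ is tangent to the orbit,
and by symmetry of the shape operator it has norm zero.

Variational completeness enters once, in `IsVariationallyComplete.action_eq_zero`: if q and Xq both
lie in ν, the Jacobi field X(p + s(q - p)) - sXq vanishes at s = 1, so it is Killing, and this
forces Xq = 0. Equivalently, the orbit of q meets ν orthogonally in a weak sense: its tangent space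
at q intersects ν only in 0.

To get full orthogonality, take ξ in ν and an eigenvector u = Xp of the shape operator, where the
tangential part of Xξ is cu. Since p itself lies in ν, the previous fact applies to q = ξ - cp and
gives Xξ = cu. Eigenvectors span the tangent space, so the tangent space at ξ is contained in that
at p, and ν is perpendicular to every orbit it meets. It meets every orbit by compactness: maximize
the inner product with p along the orbit. -/

theorem IsSmoothRep.hasMFDerivAt (hρ : IsSmoothRep (E := E) ρ) (x : V) (g : G) :
    HasMFDerivAt 𝓘(ℝ, E) 𝓘(ℝ, V) (fun g : G => ρ g x) g
      (mfderiv 𝓘(ℝ, E) 𝓘(ℝ, V) (fun g : G => ρ g x) g) :=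
  ((hρ x).mdifferentiable (by simp) g).hasMFDerivAt

theorem IsSmoothRep.orbitDeriv_add (hρ : IsSmoothRep (E := E) ρ) (x y : V)
    (X : GroupLieAlgebra 𝓘(ℝ, E) G) :
    orbitDeriv ρ (x + y) X = orbitDeriv ρ x X + orbitDeriv ρ y X := by
  have h := (hρ.hasMFDerivAt x 1).add (hρ.hasMFDerivAt y 1)
  have e : (fun g : G => ρ g (x + y)) = (fun g : G => ρ g x) + fun g : G => ρ g y := by
    ext g; simp
  have h2 := h.mfderiv
  rw [← e] at h2
  exact congrArg (fun T => T X) h2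

theorem IsSmoothRep.orbitDeriv_smul (hρ : IsSmoothRep (E := E) ρ) (c : ℝ) (x : V)
    (X : GroupLieAlgebra 𝓘(ℝ, E) G) :
    orbitDeriv ρ (c • x) X = c • orbitDeriv ρ x X := by
  have h := (hρ.hasMFDerivAt x 1).const_smul c
  have e : (fun g : G => ρ g (c • x)) = c • (fun g : G => ρ g x) := by
    ext g; simp
  have h2 := h.mfderiv
  rw [← e] at h2
  exact congrArg (fun T => T X) h2

/-- The derivative of the representation, as a map to the linear endomorphisms of `V`, with the
vector of `V` as first variable. -/
def IsSmoothRep.action (hρ : IsSmoothRep (E := E) ρ) :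
    V →ₗ[ℝ] E →ₗ[ℝ] V where
  toFun x := (orbitDeriv ρ x : E →L[ℝ] V).toLinearMap
  map_add' x y := by ext X; exact hρ.orbitDeriv_add x y X
  map_smul' c x := by ext X; exact hρ.orbitDeriv_smul c x X

theorem IsSmoothRep.range_action (hρ : IsSmoothRep (E := E) ρ) (x : V) :
    LinearMap.range (hρ.action x) = orbitTangent (E := E) ρ x := rfl

omit [TopologicalSpace G] in
theorem map_mul_vec (ρ : G →* (V ≃ₗᵢ[ℝ] V)) (g h : G) (x : V) : ρ (g * h) x = ρ g (ρ h x) := by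
  rw [map_mul]; rfl

omit [TopologicalSpace G] in
theorem map_inv_map_vec (ρ : G →* (V ≃ₗᵢ[ℝ] V)) (g : G) (x : V) : ρ g⁻¹ (ρ g x) = x := by
  rw [← map_mul_vec, inv_mul_cancel, map_one]; rfl

omit [TopologicalSpace G] in
theorem map_map_inv_vec (ρ : G →* (V ≃ₗᵢ[ℝ] V)) (g : G) (x : V) : ρ g (ρ g⁻¹ x) = x := by
  rw [← map_mul_vec, mul_inv_cancel, map_one]; rfl

theorem IsSmoothRep.mem_orbitNormal_iff (hρ : IsSmoothRep (E := E) ρ) {x y : V} :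
    y ∈ orbitNormal (E := E) ρ x ↔ ∀ X : E, inner ℝ (hρ.action x X) y = 0 := by
  rw [orbitNormal, Submodule.mem_orthogonal]
  constructor
  · exact fun h X => h _ ⟨X, rfl⟩
  · rintro h _ ⟨X, rfl⟩
    exact h X

/-- A curve in `G` through `1` with velocity `X` moves a vector `x` with velocity `X x`. -/
theorem IsSmoothRep.hasDerivAt_curve (hρ : IsSmoothRep (E := E) ρ)
    {c : ℝ → G} (hc0 : c 0 = 1) {X : E}
    (hc : HasMFDerivAt 𝓘(ℝ, ℝ) 𝓘(ℝ, E) c 0 ((1 : ℝ →L[ℝ] ℝ).smulRight X : ℝ →L[ℝ] E)) (x : V) :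
    HasDerivAt (fun t => ρ (c t) x) (hρ.action x X) 0 := by
  obtain ⟨A, hA, hA1⟩ : ∃ A : E →L[ℝ] V, (∀ X, hρ.action x X = A X) ∧
      HasMFDerivAt 𝓘(ℝ, E) 𝓘(ℝ, V) (fun g : G => ρ g x) 1 A :=
    ⟨orbitDeriv ρ x, fun _ => rfl, hρ.hasMFDerivAt x 1⟩
  -- The chain rule needs the derivative at `c 0`, which equals `1` only through `hc0`.
  have h1 : ∀ g : G, g = 1 → HasMFDerivAt 𝓘(ℝ, E) 𝓘(ℝ, V) (fun g : G => ρ g x) g A := by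
    rintro _ rfl
    exact hA1
  have h : HasFDerivAt (fun t => ρ (c t) x) (A.comp ((1 : ℝ →L[ℝ] ℝ).smulRight X)) 0 :=
    HasMFDerivAt.hasFDerivAt ((h1 _ hc0).comp 0 hc)
  simpa [hA] using h.hasDerivAt

/-- The curve that is a straight line in the preferred chart at `1`. -/
def chartCurve (X : E) (t : ℝ) : G :=
  (extChartAt 𝓘(ℝ, E) (1 : G)).symm (extChartAt 𝓘(ℝ, E) (1 : G) 1 + t • X)

theorem chartCurve_zero (X : E) : chartCurve (G := G) X 0 = 1 := by
  simp [chartCurve]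

theorem eventually_chartCurve_mem (X : E) : ∀ᶠ t : ℝ in 𝓝 0,
    extChartAt 𝓘(ℝ, E) (1 : G) 1 + t • X ∈ (extChartAt 𝓘(ℝ, E) (1 : G)).target := by
  have h : ContinuousAt (fun t : ℝ => extChartAt 𝓘(ℝ, E) (1 : G) 1 + t • X) 0 := by fun_prop
  apply h.eventually_mem
  simpa using extChartAt_target_mem_nhds (I := 𝓘(ℝ, E)) (1 : G)

theorem contMDiffAt_chartCurve [IsManifold 𝓘(ℝ, E) ∞ G] (X : E) {t : ℝ}
    (ht : extChartAt 𝓘(ℝ, E) (1 : G) 1 + t • X ∈ (extChartAt 𝓘(ℝ, E) (1 : G)).target) :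
    ContMDiffAt 𝓘(ℝ, ℝ) 𝓘(ℝ, E) ∞ (chartCurve (G := G) X) t := by
  have h1 := (contMDiffOn_extChartAt_symm (I := 𝓘(ℝ, E)) (n := ∞) (1 : G)).contMDiffAt
    ((isOpen_extChartAt_target (I := 𝓘(ℝ, E)) (1 : G)).mem_nhds ht)
  have h2 : ContMDiffAt 𝓘(ℝ, ℝ) 𝓘(ℝ, E) ∞
      (fun t : ℝ => extChartAt 𝓘(ℝ, E) (1 : G) 1 + t • X) t := by
    rw [contMDiffAt_iff_contDiffAt]
    fun_prop
  exact ContMDiffAt.comp (f := fun t : ℝ => extChartAt 𝓘(ℝ, E) (1 : G) 1 + t • X) t h1 h2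

theorem hasMFDerivAt_chartCurve [IsManifold 𝓘(ℝ, E) ∞ G] (X : E) :
    HasMFDerivAt 𝓘(ℝ, ℝ) 𝓘(ℝ, E) (chartCurve (G := G) X) 0
      ((1 : ℝ →L[ℝ] ℝ).smulRight X : ℝ →L[ℝ] E) := by
  refine ⟨(contMDiffAt_chartCurve (G := G) X (eventually_chartCurve_mem X).self_of_nhds).continuousAt,
    ?_⟩
  have h : HasFDerivAt (fun t : ℝ => extChartAt 𝓘(ℝ, E) (1 : G) 1 + t • X)
      ((1 : ℝ →L[ℝ] ℝ).smulRight X : ℝ →L[ℝ] E) 0 :=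
    ((1 : ℝ →L[ℝ] ℝ).smulRight X).hasFDerivAt.const_add _
  refine HasFDerivAt.hasFDerivWithinAt ?_
  refine h.congr_of_eventuallyEq ?_
  filter_upwards [eventually_chartCurve_mem (G := G) X] with t ht
  simp only [writtenInExtChartAt, extChartAt_model_space_eq_id, chartCurve_zero,
    Function.comp_apply]
  exact (extChartAt 𝓘(ℝ, E) (1 : G)).right_inv ht

theorem IsSmoothRep.hasDerivAt_chartCurve [IsManifold 𝓘(ℝ, E) ∞ G] (hρ : IsSmoothRep (E := E) ρ)
    (X : E) (x : V) :
    HasDerivAt (fun t => ρ (chartCurve (E := E) (G := G) X t) x) (hρ.action x X) 0 :=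
  hρ.hasDerivAt_curve (chartCurve_zero X) (hasMFDerivAt_chartCurve X) x

/-- Differentiating the constant inner product of two vectors moved by the same isometries shows
that the Lie algebra acts by skew endomorphisms. -/
theorem IsSmoothRep.inner_action_left [IsManifold 𝓘(ℝ, E) ∞ G] (hρ : IsSmoothRep (E := E) ρ)
    (X : E) (x y : V) :
    inner ℝ (hρ.action x X) y = - inner ℝ x (hρ.action y X) := by
  have h := (hρ.hasDerivAt_chartCurve (E := E) X x).inner ℝ (hρ.hasDerivAt_chartCurve (E := E) X y)
  simp only [LinearIsometryEquiv.inner_map_map, chartCurve_zero, map_one,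
    LinearIsometryEquiv.coe_one, id_eq] at h
  have := h.unique (hasDerivAt_const 0 _)
  linarith

/-- Since c(t)g = g(g⁻¹c(t)g), the vector Y = Ad(g⁻¹)X works; it appears as the velocity of the
conjugated curve. -/
theorem IsSmoothRep.orbitDeriv_map [LieGroup 𝓘(ℝ, E) ∞ G] (hρ : IsSmoothRep (E := E) ρ) (g : G)
    (x : V) (X : E) :
    ∃ Y : E, hρ.action (ρ g x) X = ρ g (hρ.action x Y) := by
  have hs : ContMDiff 𝓘(ℝ, E) 𝓘(ℝ, E) ∞ (fun h : G => g⁻¹ * h * g) :=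
    (contMDiff_const.mul contMDiff_id).mul contMDiff_const
  obtain ⟨L, hL⟩ : ∃ L : E →L[ℝ] E, HasMFDerivAt 𝓘(ℝ, E) 𝓘(ℝ, E) (fun h : G => g⁻¹ * h * g)
      (chartCurve (E := E) X 0) L := ⟨_, (hs.mdifferentiable (by simp) _).hasMFDerivAt⟩
  have hc' : HasMFDerivAt 𝓘(ℝ, ℝ) 𝓘(ℝ, E) (fun t => g⁻¹ * chartCurve (E := E) (G := G) X t * g) 0
      ((1 : ℝ →L[ℝ] ℝ).smulRight (L X) : ℝ →L[ℝ] E) := by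
    have e : L.comp ((1 : ℝ →L[ℝ] ℝ).smulRight X : ℝ →L[ℝ] E) =
      ((1 : ℝ →L[ℝ] ℝ).smulRight (L X) : ℝ →L[ℝ] E) := by ext; simp
    rw [← e]
    exact hL.comp 0 (hasMFDerivAt_chartCurve (E := E) (G := G) X)
  refine ⟨L X, ?_⟩
  have h1 := hρ.hasDerivAt_curve (by simp [chartCurve_zero]) hc' x
  have h2 := (ρ g).toContinuousLinearEquiv.toContinuousLinearMap.hasFDerivAt.comp_hasDerivAt 0 h1
  have h3 := hρ.hasDerivAt_chartCurve (E := E) X (ρ g x)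
  refine h3.unique ?_
  refine h2.congr_of_eventuallyEq (Eventually.of_forall fun t => ?_)
  change ρ _ _ = ρ g (ρ _ x)
  rw [← map_mul_vec, ← map_mul_vec]
  congr 2
  group

theorem IsSmoothRep.orbitTangent_map [LieGroup 𝓘(ℝ, E) ∞ G] (hρ : IsSmoothRep (E := E) ρ) (g : G)
    (x : V) :
    orbitTangent (E := E) ρ (ρ g x) =
      (orbitTangent (E := E) ρ x).map (ρ g).toLinearEquiv.toLinearMap := by
  have key : ∀ (g : G) (x : V), orbitTangent (E := E) ρ (ρ g x) ≤
      (orbitTangent (E := E) ρ x).map (ρ g).toLinearEquiv.toLinearMap := by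
    rintro g x _ ⟨X, rfl⟩
    obtain ⟨Y, hY⟩ := hρ.orbitDeriv_map g x X
    exact ⟨_, ⟨Y, rfl⟩, hY.symm⟩
  refine le_antisymm (key g x) ?_
  rintro _ ⟨u, hu, rfl⟩
  have h := key g⁻¹ (ρ g x)
  rw [map_inv_map_vec] at h
  obtain ⟨v, hv, rfl⟩ := h hu
  simpa [map_map_inv_vec] using hv

theorem IsSmoothRep.map_mem_orbitNormal [LieGroup 𝓘(ℝ, E) ∞ G] (hρ : IsSmoothRep (E := E) ρ)
    (g : G) {x y : V} (h : y ∈ orbitNormal (E := E) ρ x) :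
    ρ g y ∈ orbitNormal (E := E) ρ (ρ g x) := by
  rw [hρ.mem_orbitNormal_iff] at h ⊢
  intro X
  obtain ⟨Y, hY⟩ := hρ.orbitDeriv_map g x X
  rw [hY, LinearIsometryEquiv.inner_map_map]
  exact h Y

variable [FiniteDimensional ℝ V]

/-- The action of a Lie algebra element as a continuous linear endomorphism of `V`. -/
def IsSmoothRep.endo (hρ : IsSmoothRep (E := E) ρ) (X : E) : V →L[ℝ] V :=
  LinearMap.toContinuousLinearMap (hρ.action.flip X)

theorem IsSmoothRep.endo_apply (hρ : IsSmoothRep (E := E) ρ) (x : V)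
    (X : E) : hρ.endo X x = hρ.action x X := rfl

/-- The shape operator of an orbit is symmetric. -/
theorem IsSmoothRep.inner_action_symm [LieGroup 𝓘(ℝ, E) ∞ G] (hρ : IsSmoothRep (E := E) ρ)
    {p ξ : V} (hξ : ξ ∈ orbitNormal (E := E) ρ p) (X Y : E) :
    inner ℝ (hρ.action ξ X) (hρ.action p Y) = inner ℝ (hρ.action ξ Y) (hρ.action p X) := by
  -- Move p and ξ together by a curve c with velocity Y. Then ⟨X(c(t)p), c(t)ξ⟩ is identically 0,
  -- and its derivative gives ⟨Xp, Yξ⟩ + ⟨X(Yp), ξ⟩ = 0; skewness of X finishes.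
  have h1 := (hρ.endo X).hasFDerivAt.comp_hasDerivAt 0 (hρ.hasDerivAt_chartCurve (E := E) Y p)
  have h := h1.inner ℝ (hρ.hasDerivAt_chartCurve (E := E) Y ξ)
  have e : (fun t => inner ℝ ((hρ.endo X ∘ fun t => ρ (chartCurve (E := E) Y t) p) t)
      (ρ (chartCurve (E := E) Y t) ξ)) = fun _ => (0 : ℝ) := by
    ext t
    exact hρ.mem_orbitNormal_iff.1 (hρ.map_mem_orbitNormal (chartCurve (E := E) Y t) hξ) X
  rw [e] at h
  have h2 := h.unique (hasDerivAt_const 0 _)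
  simp only [Function.comp_apply, chartCurve_zero, map_one, LinearIsometryEquiv.coe_one, id_eq,
    hρ.endo_apply] at h2
  have h3 := hρ.inner_action_left X (hρ.action p Y) ξ
  linarith [real_inner_comm (hρ.action ξ Y) (hρ.action p X),
    real_inner_comm (hρ.action ξ X) (hρ.action p Y)]

end OrbitMap

/-! ### Linear pencils of bounded rank. -/

open Module in
/-- If the rank of `D + t • D'` does not exceed that of `D` for small `t`, then `D'` maps the kernel
of `D` to the range of `D`. -/
theorem mem_range_of_eventually_finrank_le {E V : Type*} [AddCommGroup E] [Module ℝ E]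
    [NormedAddCommGroup V] [NormedSpace ℝ V] [FiniteDimensional ℝ V] {D D' : E →ₗ[ℝ] V}
    (h : ∀ᶠ t : ℝ in 𝓝 0,
      finrank ℝ (LinearMap.range (D + t • D')) ≤ finrank ℝ (LinearMap.range D))
    {X : E} (hX : D X = 0) : D' X ∈ LinearMap.range D := by
  by_contra hn
  set b := finBasis ℝ (LinearMap.range D)
  have hb : ∀ i, ∃ e : E, D e = b i := fun i => (b i).2
  choose e he using hb
  -- If D'X were outside the range of D, these vectors would be independent at t = 0, hence for
  -- small t. For t ≠ 0 they all lie in the range of D + tD', which would then have too large a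
  -- rank.
  let f : ℝ → Fin (finrank ℝ (LinearMap.range D) + 1) → V :=
    fun t => Fin.cons (D' X) (fun i => D (e i) + t • D' (e i))
  have hf0 : LinearIndependent ℝ (f 0) := by
    simp only [f, zero_smul, add_zero]
    rw [linearIndependent_finCons]
    have hli : LinearIndependent ℝ (fun i => D (e i)) := by
      simp only [he]
      exact b.linearIndependent.map' _ (Submodule.ker_subtype _)
    refine ⟨hli, fun hm => hn ?_⟩
    refine Submodule.span_le.2 ?_ hm
    rintro _ ⟨i, rfl⟩
    exact ⟨e i, rfl⟩
  have hfc : ContinuousAt f 0 := by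
    refine continuousAt_pi.2 fun i => ?_
    refine Fin.cases ?_ (fun i => ?_) i
    · simpa [f] using continuousAt_const
    · simp only [f, Fin.cons_succ]
      fun_prop
  have hev := (hfc.eventually hf0.eventually).and h
  obtain ⟨t, ⟨hli, hr⟩, ht⟩ :=
    ((hev.filter_mono (nhdsWithin_le_nhds (s := {0}ᶜ))).and self_mem_nhdsWithin).exists
  have ht0 : t ≠ 0 := ht
  have hs : Submodule.span ℝ (range (f t)) ≤ LinearMap.range (D + t • D') := by
    refine Submodule.span_le.2 ?_
    rintro _ ⟨i, rfl⟩
    refine Fin.cases ?_ (fun i => ?_) i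
    -- As DX = 0, the pencil sends t⁻¹X to D'X; this is why t is taken nonzero.
    · exact ⟨t⁻¹ • X, by simp [f, hX, ht0]⟩
    · exact ⟨e i, by simp [f]⟩
  have := Submodule.finrank_mono hs
  rw [finrank_span_eq_card hli, Fintype.card_fin] at this
  omega

/-! ### Regular points and the use of variational completeness. -/

section Regular

variable {E : Type*} [NormedAddCommGroup E] [NormedSpace ℝ E]
  {G : Type*} [Group G] [TopologicalSpace G] [ChartedSpace E G]
  {V : Type*} [NormedAddCommGroup V] [InnerProductSpace ℝ V]
  {ρ : G →* (V ≃ₗᵢ[ℝ] V)}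

variable (E) in
/-- The orbits near `p` have at most the dimension of the orbit of `p`. -/
def IsRegular (ρ : G →* (V ≃ₗᵢ[ℝ] V)) (p : V) : Prop :=
  ∀ᶠ q in 𝓝 p, Module.finrank ℝ (orbitTangent (E := E) ρ q) ≤
    Module.finrank ℝ (orbitTangent (E := E) ρ p)

/-- Orbits lie in spheres about the origin. This allows normal vectors to be shifted by multiples of
p. -/
theorem IsSmoothRep.mem_orbitNormal_self [LieGroup 𝓘(ℝ, E) ∞ G] (hρ : IsSmoothRep (E := E) ρ)
    (p : V) : p ∈ orbitNormal (E := E) ρ p := by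
  rw [hρ.mem_orbitNormal_iff]
  intro X
  have := hρ.inner_action_left X p p
  rw [real_inner_comm p] at this
  linarith [real_inner_comm p (hρ.action p X)]

theorem isHorizontalGeodesic_line {x v : V} (h : v ∈ orbitNormal (E := E) ρ x) :
    IsHorizontalGeodesic (E := E) ρ (fun s : ℝ => x + s • v) := by
  refine ⟨⟨x, v, fun _ => rfl⟩, 0, ?_⟩
  have : HasDerivAt (fun s : ℝ => x + s • v) ((1 : ℝ) • v) 0 :=
    ((hasDerivAt_id (0 : ℝ)).smul_const v).const_add x
  rw [this.deriv]
  simpa using h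

variable [FiniteDimensional ℝ V]

/-- The infinitesimal slice representation at a regular point is trivial. -/
theorem IsRegular.action_eq_zero [LieGroup 𝓘(ℝ, E) ∞ G] (hρ : IsSmoothRep (E := E) ρ) {p : V}
    (hp : IsRegular E ρ p) {X : E} (hX : hρ.action p X = 0) {ξ : V}
    (hξ : ξ ∈ orbitNormal (E := E) ρ p) : hρ.action ξ X = 0 := by
  have hc : ContinuousAt (fun t : ℝ => p + t • ξ) 0 := by fun_prop
  have h1 : ∀ᶠ t : ℝ in 𝓝 0, Module.finrank ℝ (LinearMap.range (hρ.action p + t • hρ.action ξ)) ≤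
      Module.finrank ℝ (LinearMap.range (hρ.action p)) := by
    have h2 : Tendsto (fun t : ℝ => p + t • ξ) (𝓝 0) (𝓝 p) := by simpa [ContinuousAt] using hc
    filter_upwards [h2.eventually hp] with t ht
    rw [← hρ.range_action, map_add, map_smul] at ht
    exact ht
  -- With Xξ = Yp, symmetry gives |Xξ|² = ⟨Xξ, Yp⟩ = ⟨Yξ, Xp⟩ = 0.
  obtain ⟨Y, hY⟩ := mem_range_of_eventually_finrank_le h1 hX
  have h3 := hρ.inner_action_symm hξ X Y
  rw [hX, inner_zero_right, hY] at h3
  exact inner_self_eq_zero.1 h3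

/-- The field `s ↦ X (p + s ξ) + s ζ` is a Jacobi field of the orbit of `p`. -/
theorem IsSmoothRep.isOrbitJacobi [LieGroup 𝓘(ℝ, E) ∞ G] (hρ : IsSmoothRep (E := E) ρ)
    {p ξ ζ : V} (hξ : ξ ∈ orbitNormal (E := E) ρ p) (hζ : ζ ∈ orbitNormal (E := E) ρ p) (X : E) :
    IsOrbitJacobi (E := E) ρ (orbit ρ p) (fun s => p + s • ξ)
      (fun s => hρ.action (p + s • ξ) X + s • ζ) := by
  obtain ⟨ε, hε, hball⟩ := Metric.eventually_nhds_iff.1 (eventually_chartCurve_mem (G := G) X)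
  have hsm : ∀ t ∈ Ioo (-ε) ε, ∀ w : V,
      ContDiffAt ℝ ∞ (fun t => ρ (chartCurve (G := G) X t) w) t := by
    intro t ht w
    rw [← contMDiffAt_iff_contDiffAt]
    exact ContMDiffAt.comp t ((hρ w) _) (contMDiffAt_chartCurve X (hball (by
      rw [Real.dist_eq, sub_zero]; exact abs_lt.2 ht)))
  -- The line from p with normal direction ξ + tζ, carried along by the group; equivariance keeps it
  -- horizontal.
  refine ⟨ε, hε, fun t s => ρ (chartCurve (G := G) X t) (p + s • (ξ + t • ζ)), ?_, ?_, ?_, ?_⟩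
  -- Only orbit maps of fixed vectors are known to be smooth, so the moving vector is expanded in a
  -- basis.
  · let b := stdOrthonormalBasis ℝ V
    have e : (fun z : ℝ × ℝ => ρ (chartCurve (G := G) X z.1) (p + z.2 • (ξ + z.1 • ζ))) =
        fun z : ℝ × ℝ => ∑ i, (inner ℝ (b i) (p + z.2 • (ξ + z.1 • ζ)) : ℝ) •
          ρ (chartCurve (G := G) X z.1) (b i) := by
      ext z
      conv_lhs => rw [← b.sum_repr' (p + z.2 • (ξ + z.1 • ζ))]
      simp only [map_sum, map_smul]
    rw [e]
    rintro ⟨t, s⟩ ⟨ht, -⟩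
    refine ContDiffAt.contDiffWithinAt (ContDiffAt.sum fun i _ => ContDiffAt.smul ?_ ?_)
    · exact ContDiffAt.inner ℝ contDiffAt_const (by fun_prop)
    · exact ContDiffAt.comp (t, s) (hsm t ht (b i)) contDiffAt_fst
  · ext s
    simp [chartCurve_zero]
  · intro t ht
    constructor
    · have h := hρ.map_mem_orbitNormal (chartCurve X t)
        (Submodule.add_mem _ hξ (Submodule.smul_mem _ t hζ))
      simpa only [map_add, map_smul] using isHorizontalGeodesic_line h
    · exact ⟨chartCurve X t, by simp⟩
  · intro s
    have h1 := hρ.hasDerivAt_chartCurve (G := G) X (p + s • ξ)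
    have h2 := HasDerivAt.smul (hasDerivAt_id (0 : ℝ))
      ((hρ.hasDerivAt_chartCurve (G := G) X (s • ζ)))
    have h := h1.add h2
    have e : (fun t => ρ (chartCurve (G := G) X t) (p + s • (ξ + t • ζ))) =
        (fun t => ρ (chartCurve (G := G) X t) (p + s • ξ)) +
          (id : ℝ → ℝ) • (fun t => ρ (chartCurve (G := G) X t) (s • ζ)) := by
      ext t
      simp [smul_comm s t, add_assoc]
    rw [e, h.deriv]
    simp [chartCurve_zero]

/-- The Jacobi field with ξ = q - p and ζ = -Xq vanishes at s = 1, so it is Killing for some Y. At s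
= 0 this gives (X - Y)p = 0, so X - Y kills ν and Xq = Yq; at s = 1 it gives Yq = 0. -/
theorem IsVariationallyComplete.action_eq_zero [LieGroup 𝓘(ℝ, E) ∞ G]
    (hρ : IsSmoothRep (E := E) ρ) (hvc : IsVariationallyComplete (E := E) ρ) {p : V}
    (hp : IsRegular E ρ p) {q : V} (hq : q ∈ orbitNormal (E := E) ρ p) {X : E}
    (hX : hρ.action q X ∈ orbitNormal (E := E) ρ p) : hρ.action q X = 0 := by
  have hξ := Submodule.sub_mem _ hq (hρ.mem_orbitNormal_self p)
  have hζ := Submodule.neg_mem _ hX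
  obtain ⟨Y, hY⟩ : ∃ Y : E, ∀ s : ℝ, hρ.action (p + s • (q - p)) X + s • -(hρ.action q X) =
      hρ.action (p + s • (q - p)) Y := hvc p _ _ (isHorizontalGeodesic_line hξ) ⟨1, by simp⟩
    (hρ.isOrbitJacobi hξ hζ X) ⟨1, one_pos, by simp⟩
  have h0 := hY 0
  have h1 := hY 1
  have hs : hρ.action (q - p) (X - Y) = 0 := by
    refine hp.action_eq_zero hρ ?_ hξ
    rw [map_sub]
    simpa [sub_eq_zero] using h0
  have h2 : hρ.action p (X - Y) = 0 := by
    rw [map_sub]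
    simpa [sub_eq_zero] using h0
  simp only [one_smul, add_sub_cancel] at h1
  have h3 : hρ.action q (X - Y) = 0 := by
    have : hρ.action q = hρ.action (q - p) + hρ.action p := by rw [← map_add, sub_add_cancel]
    rw [this, LinearMap.add_apply, hs, h2, add_zero]
  rw [map_sub, sub_eq_zero] at h3
  rw [h3, ← h1, add_neg_cancel]

/-- Diagonalize the shape operator and remove the tangential part of each eigenvector's image by
replacing ξ with ξ - cp. -/
theorem IsVariationallyComplete.action_mem_orbitTangent [LieGroup 𝓘(ℝ, E) ∞ G]
    (hρ : IsSmoothRep (E := E) ρ) (hvc : IsVariationallyComplete (E := E) ρ) {p : V}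
    (hp : IsRegular E ρ p) {ξ : V} (hξ : ξ ∈ orbitNormal (E := E) ρ p) (X : E) :
    hρ.action ξ X ∈ orbitTangent (E := E) ρ p := by
  set T := orbitTangent (E := E) ρ p with hT
  obtain ⟨L, hL⟩ : ∃ L : T →ₗ[ℝ] E, ∀ u : T, hρ.action p (L u) = u := by
    obtain ⟨L, hL⟩ := (hρ.action p).rangeRestrict.exists_rightInverse_of_surjective
      (LinearMap.range_rangeRestrict _)
    exact ⟨L, fun u => congrArg Subtype.val (LinearMap.congr_fun hL u)⟩
  -- The shape operator in direction ξ, up to sign, through a linear choice `L` of Lie algebra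
  -- elements with (L u)p = u.
  let A : T →ₗ[ℝ] T := T.orthogonalProjectionOnto.toLinearMap ∘ₗ hρ.action ξ ∘ₗ L
  have hAin : ∀ u v : T, inner ℝ (A u) v = inner ℝ (hρ.action ξ (L u)) (hρ.action p (L v)) := by
    intro u v
    rw [hL]
    exact Submodule.inner_orthogonalProjectionOnto_eq_of_mem_right v _
  have hA : A.IsSymmetric := by
    intro u v
    rw [← real_inner_comm u, hAin, hAin]
    exact hρ.inner_action_symm hξ _ _
  have hD : ∀ u : T, hρ.action ξ (L u) ∈ T := by
    let b := hA.eigenvectorBasis rfl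
    intro u
    rw [← b.sum_repr u, map_sum, map_sum]
    refine Submodule.sum_mem _ fun i _ => ?_
    rw [map_smul, map_smul]
    refine Submodule.smul_mem _ _ ?_
    set c : ℝ := hA.eigenvalues rfl i
    have hb : A (b i) = c • b i := hA.apply_eigenvectorBasis rfl i
    have hq := Submodule.sub_mem _ hξ (Submodule.smul_mem _ c (hρ.mem_orbitNormal_self p))
    have he : hρ.action (ξ - c • p) (L (b i)) = hρ.action ξ (L (b i)) - c • (b i : V) := by
      rw [map_sub, map_smul, LinearMap.sub_apply, LinearMap.smul_apply, hL]
    have hz := hvc.action_eq_zero hρ hp hq (X := L (b i)) (by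
      rw [he]
      have := Submodule.sub_starProjection_mem_orthogonal (K := T) (hρ.action ξ (L (b i)))
      have hb' : T.starProjection (hρ.action ξ (L (b i))) = c • (b i : V) :=
        congrArg Subtype.val hb
      rwa [hb'] at this)
    rw [he, sub_eq_zero] at hz
    rw [hz]
    exact Submodule.smul_mem _ _ (b i).2
  -- X and its replacement in the image of `L` agree at p, hence on ν.
  have hk : hρ.action ξ (X - L ⟨hρ.action p X, X, rfl⟩) = 0 := by
    refine hp.action_eq_zero hρ ?_ hξ
    rw [map_sub, hL, sub_self]
  rw [map_sub, sub_eq_zero] at hk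
  rw [hk]
  exact hD _

/-- The normal space at a regular point is perpendicular to all the orbits it meets. -/
theorem IsVariationallyComplete.mem_orbitNormal [LieGroup 𝓘(ℝ, E) ∞ G]
    (hρ : IsSmoothRep (E := E) ρ) (hvc : IsVariationallyComplete (E := E) ρ) {p : V}
    (hp : IsRegular E ρ p) {y w : V} (hy : y ∈ orbitNormal (E := E) ρ p)
    (hw : w ∈ orbitNormal (E := E) ρ p) : w ∈ orbitNormal (E := E) ρ y := by
  rw [hρ.mem_orbitNormal_iff]
  exact fun X => hw _ (hvc.action_mem_orbitTangent hρ hp hy X)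

end Regular

/-! ### Principal points are regular. -/

section Principal

variable {E : Type*} [NormedAddCommGroup E] [NormedSpace ℝ E]
  {G : Type*} [Group G] [TopologicalSpace G] [ChartedSpace E G]
  {V : Type*} [NormedAddCommGroup V] [InnerProductSpace ℝ V]
  {ρ : G →* (V ≃ₗᵢ[ℝ] V)}

theorem IsSmoothRep.finrank_orbitTangent_map [LieGroup 𝓘(ℝ, E) ∞ G] (hρ : IsSmoothRep (E := E) ρ)
    (g : G) (x : V) : Module.finrank ℝ (orbitTangent (E := E) ρ (ρ g x)) =
      Module.finrank ℝ (orbitTangent (E := E) ρ x) := by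
  rw [hρ.orbitTangent_map]
  exact LinearEquiv.finrank_map_eq (ρ g).toLinearEquiv _

/-- The velocity of the curve `ρ (c t) p`, for an integral curve `c` of the left invariant vector
field of `X`. -/
theorem IsSmoothRep.hasDerivAt_integralCurve [LieGroup 𝓘(ℝ, E) ∞ G] (hρ : IsSmoothRep (E := E) ρ)
    {X : E} {c : ℝ → G} {t : ℝ}
    (hc : HasMFDerivAt 𝓘(ℝ, ℝ) 𝓘(ℝ, E) c t
      ((1 : ℝ →L[ℝ] ℝ).smulRight
        (mulInvariantVectorField (I := 𝓘(ℝ, E)) X (c t) : E) : ℝ →L[ℝ] E)) (p : V) :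
    HasDerivAt (fun t => ρ (c t) p) (ρ (c t) (hρ.action p X)) t := by
  obtain ⟨A, hA⟩ : ∃ A : E →L[ℝ] V,
      HasMFDerivAt 𝓘(ℝ, E) 𝓘(ℝ, V) (fun g : G => ρ g p) (c t) A := ⟨_, hρ.hasMFDerivAt p (c t)⟩
  obtain ⟨B, hB, hBX⟩ : ∃ B : E →L[ℝ] E, HasMFDerivAt 𝓘(ℝ, E) 𝓘(ℝ, E) (fun h : G => c t * h) 1 B ∧
      (mulInvariantVectorField (I := 𝓘(ℝ, E)) X (c t) : E) = B X :=
    ⟨_, ((contMDiff_mul_left (n := ∞)).mdifferentiable (by simp) 1).hasMFDerivAt, rfl⟩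
  have hA' : HasMFDerivAt 𝓘(ℝ, E) 𝓘(ℝ, V) (fun g : G => ρ g p) (c t * 1) A := by
    rwa [mul_one]
  obtain ⟨D, hD, hDX⟩ : ∃ D : E →L[ℝ] V,
      HasMFDerivAt 𝓘(ℝ, E) 𝓘(ℝ, V) (fun g : G => ρ g p) 1 D ∧ ∀ X, hρ.action p X = D X :=
    ⟨_, hρ.hasMFDerivAt p 1, fun _ => rfl⟩
  have h1 : HasMFDerivAt 𝓘(ℝ, E) 𝓘(ℝ, V) (fun h : G => ρ (c t * h) p) 1 (A.comp B) :=
    hA'.comp 1 hB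
  have h2 : HasMFDerivAt 𝓘(ℝ, E) 𝓘(ℝ, V) (fun h : G => ρ (c t) (ρ h p)) 1
      (((ρ (c t)).toContinuousLinearEquiv.toContinuousLinearMap).comp D) :=
    HasMFDerivAt.comp 1 ((ρ (c t)).toContinuousLinearEquiv.toContinuousLinearMap.hasMFDerivAt) hD
  -- The two factorizations of this map are differentiated at `1` and compared.
  have e : (fun h : G => ρ (c t * h) p) = fun h : G => ρ (c t) (ρ h p) := by
    ext h; exact map_mul_vec ρ _ _ _
  rw [e] at h1
  have h3 : A.comp B = ((ρ (c t)).toContinuousLinearEquiv.toContinuousLinearMap).comp D :=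
    hasMFDerivAt_unique h1 h2
  have h4 : A (B X) = ρ (c t) (hρ.action p X) := by
    rw [hDX]; exact DFunLike.congr_fun h3 X
  have hc' : HasMFDerivAt 𝓘(ℝ, ℝ) 𝓘(ℝ, E) c t ((1 : ℝ →L[ℝ] ℝ).smulRight (B X) : ℝ →L[ℝ] E) := by
    rw [← hBX]; exact hc
  have h : HasFDerivAt (fun t => ρ (c t) p) (A.comp ((1 : ℝ →L[ℝ] ℝ).smulRight (B X))) t :=
    HasMFDerivAt.hasFDerivAt (hA.comp t hc')
  rw [← h4]
  simpa using h.hasDerivAt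

/-- A Lie algebra element that annihilates `p` is the velocity of a curve in the isotropy group
of `p`. -/
theorem IsSmoothRep.exists_curve_isotropy [CompleteSpace E] [LieGroup 𝓘(ℝ, E) ∞ G]
    (hρ : IsSmoothRep (E := E) ρ) {p : V} {X : E} (hX : hρ.action p X = 0) :
    ∃ c : ℝ → G, c 0 = 1 ∧ HasMFDerivAt 𝓘(ℝ, ℝ) 𝓘(ℝ, E) c 0
      ((1 : ℝ →L[ℝ] ℝ).smulRight X : ℝ →L[ℝ] E) ∧ ∀ᶠ t in 𝓝 0, ρ (c t) p = p := by
  have : LieGroup 𝓘(ℝ, E) (minSmoothness ℝ 3) G :=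
    LieGroup.of_le (m := minSmoothness ℝ 3) (n := ∞) (by
      rw [minSmoothness_of_isRCLikeNormedField]
      exact WithTop.coe_le_coe.2 le_top)
  have hsm := (contMDiff_mulInvariantVectorField (I := 𝓘(ℝ, E)) (G := G) X).of_le
    (n := minSmoothness ℝ 2) (m := 1) (by simp)
  obtain ⟨c, hc0, hc⟩ := exists_isMIntegralCurveAt_of_contMDiffAt_boundaryless 0
    (hsm.contMDiffAt (x := 1))
  have h1 : ∀ g : G, g = 1 → (mulInvariantVectorField (I := 𝓘(ℝ, E)) X g : E) = X := by
    rintro _ rfl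
    obtain ⟨B, hB, hBX⟩ : ∃ B : E →L[ℝ] E,
        HasMFDerivAt 𝓘(ℝ, E) 𝓘(ℝ, E) (fun h : G => 1 * h) 1 B ∧
        (mulInvariantVectorField (I := 𝓘(ℝ, E)) X (1 : G) : E) = B X :=
      ⟨_, ((contMDiff_mul_left (n := ∞)).mdifferentiable (by simp) 1).hasMFDerivAt, rfl⟩
    rw [funext one_mul] at hB
    rw [hBX]
    exact DFunLike.congr_fun (hasMFDerivAt_unique hB (hasMFDerivAt_id 1)) X
  refine ⟨c, hc0, ?_, ?_⟩
  · rw [← h1 _ hc0]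
    exact hc.self_of_nhds
  -- Along the integral curve of the left invariant field, c(t)p has velocity c(t)(Xp) = 0, so it
  -- stays at p.
  · obtain ⟨ε, hε, hball⟩ := Metric.eventually_nhds_iff_ball.1 hc
    filter_upwards [Metric.ball_mem_nhds (0 : ℝ) hε] with t ht
    have hd : ∀ s ∈ Metric.ball (0 : ℝ) ε, HasDerivAt (fun t => ρ (c t) p) 0 s := by
      intro s hs
      have := hρ.hasDerivAt_integralCurve (hball s hs) p
      rwa [hX, map_zero] at this
    have := Metric.isOpen_ball.is_const_of_deriv_eq_zero
      (convex_ball (0 : ℝ) ε).isPreconnected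
      (fun s hs => (hd s hs).differentiableAt.differentiableWithinAt)
      (fun s hs => (hd s hs).deriv) ht (Metric.mem_ball_self hε)
    simpa [hc0] using this

/-- Near p, the isotropy group of p fixes a point g⁻¹q of the orbit of q. Hence its Lie algebra
annihilates that point, and rank-nullity compares orbit dimensions. -/
theorem IsPrincipal.isRegular [FiniteDimensional ℝ E] [LieGroup 𝓘(ℝ, E) ∞ G]
    (hρ : IsSmoothRep (E := E) ρ) {p : V} (hp : IsPrincipal ρ p) :
    IsRegular E ρ p := by
  have := FiniteDimensional.complete ℝ E
  filter_upwards [hp] with q hq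
  obtain ⟨g, hg⟩ := hq
  have hker : LinearMap.ker (hρ.action p) ≤ LinearMap.ker (hρ.action (ρ g⁻¹ q)) := by
    intro X hX
    obtain ⟨c, hc0, hc, hcp⟩ := hρ.exists_curve_isotropy hX
    have h := hρ.hasDerivAt_curve hc0 hc (ρ g⁻¹ q)
    refine h.unique ((hasDerivAt_const 0 (ρ g⁻¹ q)).congr_of_eventuallyEq ?_)
    filter_upwards [hcp] with t ht
    have h2 := congrArg (ρ g⁻¹) (hg _ ht)
    rwa [← map_mul_vec, mul_assoc, inv_mul_cancel_left, map_mul_vec] at h2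
  have h1 := (hρ.action p).finrank_range_add_finrank_ker
  have h2 := (hρ.action (ρ g⁻¹ q)).finrank_range_add_finrank_ker
  have h3 := Submodule.finrank_mono hker
  rw [hρ.range_action] at h1 h2
  rw [← hρ.finrank_orbitTangent_map g⁻¹ q]
  omega

end Principal

/-! ### Linear subspaces as complete immersed submanifolds. -/

section Section

variable {V : Type*} [NormedAddCommGroup V] [InnerProductSpace ℝ V] [FiniteDimensional ℝ V]

/-- Induced length bounds Euclidean distance, so the images form a Cauchy sequence in V, whose limit
lies in the closed image. -/
theorem isCompleteInduced_of_isClosedEmbedding {k : ℕ} {M : Type*} [TopologicalSpace M]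
    [ChartedSpace (EuclideanSpace ℝ (Fin k)) M] {ι : M → V} (hι : ContMDiff (𝓡 k) 𝓘(ℝ, V) 1 ι)
    (he : IsClosedEmbedding ι) : IsCompleteInduced k ι := by
  intro x hx
  have hcau : CauchySeq fun n => ι (x n) := by
    rw [EMetric.cauchySeq_iff]
    intro ε hε
    obtain ⟨n₀, hn⟩ := hx ε hε
    refine ⟨n₀, fun m hm n hn' => ?_⟩
    obtain ⟨c, hc, h0, h1, hl⟩ := hn m n hm hn'
    have hd : ContDiffOn ℝ 1 (fun s => ι (c s)) (Icc 0 1) := by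
      rw [← contMDiffOn_iff_contDiffOn]
      exact hι.comp_contMDiffOn hc
    have := enorm_sub_le_lintegral_deriv_of_contDiffOn_Icc hd zero_le_one
    rw [h0, h1] at this
    rw [edist_comm, edist_eq_enorm_sub]
    exact this.trans_lt hl
  obtain ⟨v, hv⟩ := cauchySeq_tendsto_of_complete hcau
  obtain ⟨y, rfl⟩ := he.isClosed_range.mem_of_tendsto hv (Eventually.of_forall fun n => ⟨x n, rfl⟩)
  exact ⟨y, he.isInducing.tendsto_nhds_iff.2 hv⟩

/-- A linear subspace is a complete connected immersed submanifold, tangent to itself. -/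
theorem exists_isCompleteConnectedImmersion (W : Submodule ℝ V) :
    ∃ (k : ℕ) (_ : ChartedSpace (EuclideanSpace ℝ (Fin k)) W),
      IsCompleteConnectedImmersion k (Subtype.val : W → V) ∧
      ∀ (y : W) (w : TangentSpace (𝓡 k) y),
        (mfderiv (𝓡 k) 𝓘(ℝ, V) (Subtype.val : W → V) y w : V) ∈ W := by
  let k := Module.finrank ℝ W
  let e : W ≃ₗᵢ[ℝ] EuclideanSpace ℝ (Fin k) := (stdOrthonormalBasis ℝ W).repr
  have he : IsOpenEmbedding e := e.toHomeomorph.isOpenEmbedding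
  let cs : ChartedSpace (EuclideanSpace ℝ (Fin k)) W := he.singletonChartedSpace
  let L : EuclideanSpace ℝ (Fin k) →L[ℝ] V :=
    W.subtypeL.comp e.symm.toContinuousLinearEquiv.toContinuousLinearMap
  have hman : IsManifold (𝓡 k) ∞ W := he.isManifold_singleton
  have hsm : ContMDiff (𝓡 k) (𝓡 k) ∞ e := contMDiff_isOpenEmbedding he
  have hsy : ContMDiff (𝓡 k) (𝓡 k) ∞ e.symm := by
    have h := contMDiffOn_isOpenEmbedding_symm (I := 𝓡 k) (n := ∞) he
    have hr : range e = univ := e.surjective.range_eq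
    rw [hr, contMDiffOn_univ] at h
    refine h.congr fun z => ?_
    obtain ⟨y, rfl⟩ := e.surjective z
    rw [e.symm_apply_apply]
    exact (OpenPartialHomeomorph.left_inv _ (by simp)).symm
  have hL : ContMDiff (𝓡 k) 𝓘(ℝ, V) ∞ L := L.contMDiff
  have hcomp : (Subtype.val : W → V) = L ∘ e := by
    ext y; simp [L]
  have hι : ContMDiff (𝓡 k) 𝓘(ℝ, V) ∞ (Subtype.val : W → V) := by
    rw [hcomp]; exact hL.comp hsm
  -- The inclusion is the linear injection `L` after the chart `e`; `B`, the derivative of `e.symm`,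
  -- shows that `A` is injective.
  have hder : ∀ y : W, ∃ A B : EuclideanSpace ℝ (Fin k) →L[ℝ] EuclideanSpace ℝ (Fin k),
      HasMFDerivAt (𝓡 k) 𝓘(ℝ, V) (Subtype.val : W → V) y (L.comp A) ∧ B.comp A = .id ℝ _ := by
    intro y
    obtain ⟨A, hA⟩ : ∃ A : EuclideanSpace ℝ (Fin k) →L[ℝ] EuclideanSpace ℝ (Fin k),
      HasMFDerivAt (𝓡 k) (𝓡 k) e y A := ⟨_, (hsm.mdifferentiable (by simp) y).hasMFDerivAt⟩
    obtain ⟨B, hB⟩ : ∃ B : EuclideanSpace ℝ (Fin k) →L[ℝ] EuclideanSpace ℝ (Fin k),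
      HasMFDerivAt (𝓡 k) (𝓡 k) e.symm (e y) B :=
        ⟨_, (hsy.mdifferentiable (by simp) (e y)).hasMFDerivAt⟩
    refine ⟨A, B, ?_, ?_⟩
    · rw [hcomp]
      exact HasMFDerivAt.comp y L.hasMFDerivAt hA
    · have h1 : HasMFDerivAt (𝓡 k) (𝓡 k) (e.symm ∘ e) y (B.comp A) := hB.comp y hA
      rw [e.symm_comp_self] at h1
      exact hasMFDerivAt_unique h1 (hasMFDerivAt_id y)
  have hclosed : IsClosedEmbedding (Subtype.val : W → V) :=
    W.closed_of_finiteDimensional.isClosedEmbedding_subtypeVal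
  refine ⟨k, cs, ⟨hman, inferInstance, inferInstance, inferInstance, hι, Subtype.val_injective,
    fun y => ?_, isCompleteInduced_of_isClosedEmbedding (hι.of_le (by simp)) hclosed⟩,
    fun y w => ?_⟩
  · obtain ⟨A, B, h, hBA⟩ := hder y
    rw [h.mfderiv]
    have hLi : Function.Injective L := Subtype.val_injective.comp e.symm.injective
    have hAi : Function.Injective A :=
      Function.LeftInverse.injective (g := B) fun v => DFunLike.congr_fun hBA v
    exact hLi.comp hAi
  · obtain ⟨A, B, h, -⟩ := hder y
    rw [h.mfderiv]
    exact (e.symm (A w)).2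

end Section

/-! ### Normal spaces at regular points are sections. -/

section Sections

universe u

variable {E : Type*} [NormedAddCommGroup E] [NormedSpace ℝ E]
  {G : Type*} [Group G] [TopologicalSpace G] [ChartedSpace E G] [LieGroup 𝓘(ℝ, E) ∞ G]
  {V : Type u} [NormedAddCommGroup V] [InnerProductSpace ℝ V]
  {ρ : G →* (V ≃ₗᵢ[ℝ] V)}

/-- The normal space of an orbit of a compact group meets all the orbits. -/
theorem IsSmoothRep.orbitNormal_inter_orbit_nonempty [CompactSpace G]
    (hρ : IsSmoothRep (E := E) ρ) (p x : V) :
    ((orbitNormal (E := E) ρ p : Set V) ∩ orbit ρ x).Nonempty := by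
  have hcont : Continuous fun g : G => (inner ℝ (ρ g x) p : ℝ) :=
    (hρ x).continuous.inner continuous_const
  -- At the point gx of the orbit closest to p, criticality gives ⟨X(gx), p⟩ = 0, which by skewness
  -- says that gx is normal at p.
  obtain ⟨g, -, hg⟩ := isCompact_univ.exists_isMaxOn univ_nonempty hcont.continuousOn
  refine ⟨ρ g x, ?_, g, rfl⟩
  rw [SetLike.mem_coe, hρ.mem_orbitNormal_iff]
  intro X
  have h := (hρ.hasDerivAt_chartCurve (G := G) X (ρ g x)).inner ℝ (hasDerivAt_const 0 p)
  have hmax : IsLocalMax (fun t => (inner ℝ (ρ (chartCurve (G := G) X t) (ρ g x)) p : ℝ)) 0 := by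
    refine Eventually.of_forall fun t => ?_
    have := hg (mem_univ (chartCurve (G := G) X t * g))
    simpa [chartCurve_zero] using this
  have h0 := hmax.hasDerivAt_eq_zero h
  rw [inner_zero_right, zero_add] at h0
  rw [hρ.inner_action_left, real_inner_comm, h0, neg_zero]

variable [FiniteDimensional ℝ V]

-- Orbit dimensions are bounded by dim V, so a maximum is attained. Polarity thus needs no existence
-- theorem for principal points.
omit [LieGroup 𝓘(ℝ, E) ∞ G] in
theorem exists_isRegular (ρ : G →* (V ≃ₗᵢ[ℝ] V)) : ∃ p : V, IsRegular E ρ p := by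
  let r : V → ℕ := fun q => Module.finrank ℝ (orbitTangent (E := E) ρ q)
  have hb : BddAbove (range r) :=
    ⟨Module.finrank ℝ V, by rintro _ ⟨q, rfl⟩; exact Submodule.finrank_le _⟩
  obtain ⟨p, hp⟩ := Nat.sSup_mem (range_nonempty r) hb
  refine ⟨p, Eventually.of_forall fun q => ?_⟩
  change r q ≤ r p
  rw [hp]
  exact le_csSup hb ⟨q, rfl⟩

theorem IsVariationallyComplete.isSection_orbitNormal [CompactSpace G]
    (hρ : IsSmoothRep (E := E) ρ) (hvc : IsVariationallyComplete (E := E) ρ) {p : V}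
    (hp : IsRegular E ρ p) : IsSection (E := E) ρ (orbitNormal (E := E) ρ p : Set V) := by
  obtain ⟨k, cs, hi, ht⟩ := exists_isCompleteConnectedImmersion (orbitNormal (E := E) ρ p)
  exact ⟨k, orbitNormal (E := E) ρ p, inferInstance, cs, Subtype.val, hi, Subtype.range_coe,
    hρ.orbitNormal_inter_orbit_nonempty p, fun y w => hvc.mem_orbitNormal hρ hp y.2 (ht y w)⟩

end Sections

end PolarRep

end

theorem mainTheorem4
    {E : Type*} [NormedAddCommGroup E] [NormedSpace ℝ E] [FiniteDimensional ℝ E]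
    {G : Type*} [Group G] [TopologicalSpace G] [T2Space G] [CompactSpace G]
    [ChartedSpace E G] [LieGroup 𝓘(ℝ, E) ∞ G]
    {V : Type*} [NormedAddCommGroup V] [InnerProductSpace ℝ V] [FiniteDimensional ℝ V]
    (ρ : G →* (V ≃ₗᵢ[ℝ] V)) (hρ : PolarRep.IsSmoothRep (E := E) ρ)
    (hvc : PolarRep.IsVariationallyComplete (E := E) ρ) :
    PolarRep.IsPolar (E := E) ρ ∧
      ∀ p : V, PolarRep.IsPrincipal ρ p →
        PolarRep.IsSection (E := E) ρ (PolarRep.orbitNormal (E := E) ρ p : Set V) := by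
  refine ⟨?_, fun p hp => hvc.isSection_orbitNormal hρ (hp.isRegular hρ)⟩
  obtain ⟨p, hp⟩ := PolarRep.exists_isRegular (E := E) ρ
  exact ⟨_, hvc.isSection_orbitNormal hρ hp⟩
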